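/- A Salem number is a real algebraic integer $\alpha>1$ all of whose conjugates over $\mathbb{Q}$ other than $\alpha$ itself lie in the closed unit disc $\{z\in\mathbb{C}:|z|\le 1\}$, with at least one of them on the unit circle $|z|=1$; its degree is the degree of its minimal polynomial over $\mathbb{Q}$. An algebraic integer is called a unit if it is invertible in the ring of algebraic integers. **Theorem 1.3.** Let $n$ be a natural number with $n\equiv 4 \pmod 8$ and $n\not\equiv 0\pmod 5$. Then for every odd integer $t\ge (n+6)/2$ there exist infinitely many Salem numbers $\alpha$ of degree $2t$ such that $\alpha^n-1$ is a unit. -/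

import Mathlib

/-- A Salem number is a real algebraic integer greater than `1` all of whose other conjugates
(complex roots of its minimal polynomial over `ℚ`) lie in the closed unit disc, at least one of
them lying on the unit circle. -/
def IsSalemNumber (α : ℝ) : Prop :=
  IsIntegral ℤ α ∧ 1 < α ∧
    (∀ z : ℂ, Polynomial.aeval z (minpoly ℚ α) = 0 → z ≠ (α : ℂ) → ‖z‖ ≤ 1) ∧
    ∃ z : ℂ, Polynomial.aeval z (minpoly ℚ α) = 0 ∧ ‖z‖ = 1

/-- A real number is an (algebraic) unit if it is an invertible element of the ring of real
algebraic integers. -/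
def IsAlgebraicUnit (x : ℝ) : Prop :=
  ∃ u : (integralClosure ℤ ℝ)ˣ, ((u : integralClosure ℤ ℝ) : ℝ) = x

open Polynomial Filter Topology

/-! Write `n = 2 * (k + 1)`, `β = α + α⁻¹` and `E = cyclicFactor k = (X ^ 2 - 4) * S_k`. Since `(α -
α⁻¹) * S_k(β) = α ^ (k + 1) - α⁻¹ ^ (k + 1)`, the number `α ^ n - 1` is a unit as soon as `E(β)` is.
This is forced by letting `β` be a root of `tracePoly = E * G - 1` with `G = X ^ (d + 1) - a * H`,
where `H = rationalFactor d N` has `d` rational roots just below `2`.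

For large `a` the sign of `E * G - 1` at chosen points of `(-2, 2)` is that of `-E * H`, which
alternates there. Together with the value `-1` at `±2` and positivity far to the right, this makes
all `k + d + 3` roots real and simple, one above `2` and the others in `(-2, 2)`
(`eventually_isSalemTrace`). In the reciprocal lift, `α` is then a simple root and the only one
outside the closed unit disc.

Irreducibility holds for all but finitely many `a`. Otherwise the cofactor of the minimal polynomial
of `α` has its roots in the finite set of `finite_roots_in_unit_disc`, and each number there serves
at most one `a`, because `H` has no integral root (`tracePoly_param_unique`). The same uniqueness
makes the `α` distinct. -/

/-- `R` is the trace polynomial of a Salem number with trace `β`, up to irreducibility: `β > 2` is a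
simple root, all other roots lie in `(-2, 2)`, and there is at least one of those. -/
structure IsSalemTrace (R : ℤ[X]) (β : ℝ) : Prop where
  monic : R.Monic
  two_lt : 2 < β
  root : aeval β R = 0
  simple : aeval β (derivative R) ≠ 0
  others : ∀ w : ℂ, aeval w R = 0 → w ≠ β → ∃ x : ℝ, -2 < x ∧ x < 2 ∧ w = x
  exists_root : ∃ x : ℝ, -2 < x ∧ x < 2 ∧ aeval x R = 0

/-! ### Counting real roots by sign changes. -/

theorem exists_root_of_mul_neg {f : ℝ → ℝ} (hf : Continuous f) {a b : ℝ} (hab : a < b)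
    (h : f a * f b < 0) : ∃ r, a < r ∧ r < b ∧ f r = 0 := by
  rcases mul_neg_iff.1 h with ⟨h1, h2⟩ | ⟨h1, h2⟩
  · obtain ⟨r, hr, h0⟩ := intermediate_value_Ioo' hab.le hf.continuousOn ⟨h2, h1⟩
    exact ⟨r, hr.1, hr.2, h0⟩
  · obtain ⟨r, hr, h0⟩ := intermediate_value_Ioo hab.le hf.continuousOn ⟨h1, h2⟩
    exact ⟨r, hr.1, hr.2, h0⟩

/-- A monic integer polynomial of degree `t` that changes sign along `t + 1` increasing points, all
but the last in `[-2, 2]`, the last but one being `2`, is a Salem trace polynomial. -/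
theorem exists_isSalemTrace_of_alternating {R : ℤ[X]} (hR : R.Monic) {t : ℕ} (ht : 2 ≤ t)
    (hdeg : R.natDegree = t) (x : ℕ → ℝ) (hx : ∀ i < t, x i < x (i + 1)) (h0 : x 0 = -2)
    (h2 : x (t - 1) = 2) (hsign : ∀ i < t, aeval (x i) R * aeval (x (i + 1)) R < 0) :
    ∃ β, IsSalemTrace R β := by
  have hc : Continuous fun y : ℝ => aeval y R := by fun_prop
  have hr : ∀ i, ∃ r, i < t → x i < r ∧ r < x (i + 1) ∧ aeval r R = 0 := fun i => by
    by_cases hi : i < t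
    · obtain ⟨r, hr⟩ := exists_root_of_mul_neg hc (hx i hi) (hsign i hi)
      exact ⟨r, fun _ => hr⟩
    · exact ⟨0, fun h => absurd h hi⟩
  choose r hr using hr
  have hmono : ∀ i j, i ≤ j → j ≤ t → x i ≤ x j := by
    intro i j hij
    induction j, hij using Nat.le_induction with
    | base => exact fun _ => le_rfl
    | succ j hij ih => exact fun hj => (ih (by omega)).trans (hx j hj).le
  have hlt : ∀ i j, i < j → j < t → r i < r j := fun i j hij hj =>
    ((hr i (hij.trans hj)).2.1.trans_le (hmono _ _ hij hj.le)).trans (hr j hj).1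
  have hinj : Set.InjOn r (Finset.range t) := by
    intro i hi j hj hij
    simp only [Finset.coe_range, Set.mem_Iio] at hi hj
    rcases lt_trichotomy i j with h | h | h
    · exact absurd hij (hlt i j h hj).ne
    · exact h
    · exact absurd hij (hlt j i h hi).ne'
  set f : ℝ[X] := R.map (algebraMap ℤ ℝ) with hf
  have hfm : f.Monic := hR.map _
  have hev : ∀ y : ℝ, f.eval y = aeval y R := fun y => by rw [hf, eval_map_algebraMap]
  have hdvd : ∏ i ∈ Finset.range t, (X - C (r i)) ∣ f := by
    refine Finset.prod_dvd_of_coprime ?_ ?_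
    · intro i hi j hj hij
      exact isCoprime_X_sub_C_of_isUnit_sub
        (sub_ne_zero.2 fun h => hij (hinj hi hj h)).isUnit
    · intro i hi
      rw [dvd_iff_isRoot, IsRoot, hev]
      exact (hr i (Finset.mem_range.1 hi)).2.2
  -- The `t` distinct roots exhaust the degree, so there are no other complex roots and none is
  -- multiple.
  have hprod : f = ∏ i ∈ Finset.range t, (X - C (r i)) := by
    refine (eq_of_monic_of_dvd_of_natDegree_le (monic_prod_X_sub_C _ _) hfm hdvd ?_)
    rw [natDegree_finsetProd_X_sub_C_eq_card]
    rw [hf, hR.natDegree_map, hdeg, Finset.card_range]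
  have hsep : f.Separable := by
    rw [hprod, separable_prod_X_sub_C_iff']
    exact fun i hi j hj h => hinj hi hj h
  have htl := hr (t - 1) (by omega)
  refine ⟨r (t - 1), hR, ?_, htl.2.2, ?_, ?_, r 0, ?_, ?_, (hr 0 (by omega)).2.2⟩
  · rw [← h2]; exact htl.1
  · have := hsep.eval₂_derivative_ne_zero (RingHom.id ℝ) (x := r (t - 1))
      (by rw [← eval_map, Polynomial.map_id, hev]; exact htl.2.2)
    rwa [← eval_map, Polynomial.map_id, hf, derivative_map, eval_map_algebraMap] at this
  · intro w hw hne
    have hw' : (f.map (algebraMap ℝ ℂ)).eval w = 0 := by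
      rw [hf, Polynomial.map_map, ← IsScalarTower.algebraMap_eq, eval_map_algebraMap, hw]
    rw [hprod, Polynomial.map_prod, eval_prod, Finset.prod_eq_zero_iff] at hw'
    obtain ⟨i, hi, hi0⟩ := hw'
    have hi := Finset.mem_range.1 hi
    simp [sub_eq_zero] at hi0
    have hit : i < t - 1 := by
      refine lt_of_le_of_ne (by omega) ?_
      rintro rfl
      exact hne hi0
    refine ⟨r i, ?_, ?_, hi0⟩
    · rw [← h0]
      exact (hmono 0 i (by omega) hi.le).trans_lt (hr i hi).1
    · rw [← h2]
      exact (hr i hi).2.1.trans_le (hmono _ _ hit (by omega))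
  · rw [← h0]; exact (hr 0 (by omega)).1
  · rw [← h2]; exact (hr 0 (by omega)).2.1.trans_le (hmono _ _ (by omega) (by omega))

/-! ### Reciprocal polynomials and the substitution `z + z⁻¹`. -/

/-- The reciprocal polynomial `z ^ t * R (z + z⁻¹)` of degree `2 * t`, for `R` of degree `t`. -/
noncomputable def traceLift (R : ℤ[X]) : ℤ[X] :=
  ∑ i ∈ Finset.range (R.natDegree + 1), C (R.coeff i) * ((X ^ 2 + 1) ^ i * X ^ (R.natDegree - i))

theorem aeval_traceLift {K : Type*} [Field K] (R : ℤ[X]) {z : K} (hz : z ≠ 0) :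
    aeval z (traceLift R) = z ^ R.natDegree * aeval (z + z⁻¹) R := by
  rw [traceLift, map_sum, aeval_eq_sum_range, Finset.mul_sum]
  refine Finset.sum_congr rfl fun i hi => ?_
  have hi : i ≤ R.natDegree := Nat.lt_succ_iff.1 (Finset.mem_range.1 hi)
  obtain ⟨j, hj⟩ := Nat.exists_eq_add_of_le hi
  have : z ^ 2 + 1 = z * (z + z⁻¹) := by field_simp
  simp only [map_mul, map_pow, map_add, aeval_X, map_one, this, hj, zsmul_eq_mul,
    Nat.add_sub_cancel_left, mul_pow, pow_add, eq_intCast, map_intCast]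
  ring

theorem aeval_zero_traceLift {K : Type*} [Field K] {R : ℤ[X]} (hR : R.Monic) :
    aeval (0 : K) (traceLift R) = 1 := by
  rw [traceLift, map_sum, Finset.sum_range_succ, Finset.sum_eq_zero]
  · simp [hR]
  · intro i hi
    have : R.natDegree - i ≠ 0 := by have := Finset.mem_range.1 hi; omega
    simp [this]

theorem monic_traceLift_and_natDegree {R : ℤ[X]} (hR : R.Monic) :
    (traceLift R).Monic ∧ (traceLift R).natDegree = 2 * R.natDegree := by
  have h1 : (X ^ 2 + 1 : ℤ[X]).Monic := monic_X_pow_add_C (1 : ℤ) two_ne_zero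
  have hm : ∀ i j : ℕ, ((X ^ 2 + 1 : ℤ[X]) ^ i * X ^ j).Monic := fun i j =>
    (h1.pow i).mul (monic_X_pow j)
  have h2 : (X ^ 2 + 1 : ℤ[X]).natDegree = 2 := natDegree_X_pow_add_C (r := (1 : ℤ))
  have hd : ∀ i j : ℕ, ((X ^ 2 + 1 : ℤ[X]) ^ i * X ^ j).natDegree = 2 * i + j := fun i j => by
    rw [(h1.pow i).natDegree_mul (monic_X_pow j), h1.natDegree_pow, h2, natDegree_X_pow, mul_comm]
  have hlow : (∑ i ∈ Finset.range R.natDegree,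
      C (R.coeff i) * ((X ^ 2 + 1) ^ i * X ^ (R.natDegree - i))).degree <
      ((X ^ 2 + 1 : ℤ[X]) ^ R.natDegree * X ^ 0).degree := by
    rw [degree_eq_natDegree (hm _ _).ne_zero, hd]
    refine (degree_sum_le _ _).trans_lt ((Finset.sup_lt_iff (WithBot.bot_lt_coe _)).2 ?_)
    intro i hi
    have := Finset.mem_range.1 hi
    refine ((degree_mul_le _ _).trans (add_le_add_left degree_C_le _)).trans_lt ?_
    rw [degree_eq_natDegree (hm _ _).ne_zero, hd, zero_add]
    exact_mod_cast (by omega : 2 * i + (R.natDegree - i) < 2 * R.natDegree + 0)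
  have heq : traceLift R = (∑ i ∈ Finset.range R.natDegree,
      C (R.coeff i) * ((X ^ 2 + 1) ^ i * X ^ (R.natDegree - i))) +
      (X ^ 2 + 1 : ℤ[X]) ^ R.natDegree * X ^ 0 := by
    rw [traceLift, Finset.sum_range_succ, hR.coeff_natDegree, Nat.sub_self, C_1, one_mul]
  constructor
  · rw [heq]; exact (hm _ _).add_of_right hlow
  · rw [heq, natDegree_add_eq_right_of_degree_lt hlow, hd, add_zero]

/-- Algebraic integers of bounded degree all of whose conjugates lie in the closed unit disc form a
finite set (stated for roots of arbitrary monic polynomials). -/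
theorem finite_roots_in_unit_disc (d : ℕ) :
    {z : ℂ | ∃ Q : ℤ[X], Q.Monic ∧ Q.natDegree ≤ d ∧ (∀ w : ℂ, aeval w Q = 0 → ‖w‖ ≤ 1) ∧
      aeval z Q = 0}.Finite := by
  classical
  -- The coefficient bound of `coeff_bdd_of_roots_le` for roots of norm at most `1`; integer
  -- coefficients then take finitely many values.
  set B : ℝ := max 1 1 ^ d * d.choose (d / 2)
  refine (bUnion_roots_finite (algebraMap ℤ ℂ) d (Set.finite_Icc (-⌈B⌉) ⌈B⌉)).subset ?_
  rintro z ⟨Q, hQ, hd, hr, hz⟩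
  simp only [Set.mem_iUnion]
  refine ⟨Q, ⟨hd, fun i => ?_⟩, ?_⟩
  · have h := coeff_bdd_of_roots_le (F := ℚ) (B := 1) (d := d) (algebraMap ℚ ℂ)
      (p := Q.map (algebraMap ℤ ℚ)) (hQ.map _) (IsAlgClosed.splits _)
      (by rwa [hQ.natDegree_map]) (fun w hw => hr w (by
        rw [Polynomial.map_map, ← IsScalarTower.algebraMap_eq] at hw
        have := (mem_roots'.1 hw).2
        rwa [IsRoot, eval_map_algebraMap] at this)) i
    rw [Polynomial.map_map, ← IsScalarTower.algebraMap_eq, coeff_map, eq_intCast,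
      Complex.norm_intCast] at h
    have h' : |(Q.coeff i : ℝ)| ≤ ⌈B⌉ := h.trans (Int.le_ceil _)
    rw [Set.mem_Icc, ← abs_le]
    exact_mod_cast h'
  · simp only [Finset.mem_coe, Multiset.mem_toFinset]
    rw [mem_roots (hQ.map _).ne_zero, IsRoot, eval_map_algebraMap, hz]

theorem norm_eq_one_of_add_inv_eq {z : ℂ} (hz : z ≠ 0) {x : ℝ} (h1 : -2 < x) (h2 : x < 2)
    (h : z + z⁻¹ = x) : ‖z‖ = 1 := by
  have hq : z ^ 2 - x * z + 1 = 0 := by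
    field_simp at h
    linear_combination h
  have hre := congrArg Complex.re hq
  have him := congrArg Complex.im hq
  simp [pow_two] at hre him
  -- A real `z` would give `(z - x / 2) ^ 2 + (1 - x ^ 2 / 4) = 0`, a sum with positive second term.
  have hy : z.im ≠ 0 := fun hy => by
    rw [hy] at hre
    nlinarith [sq_nonneg (z.re - x / 2)]
  have hx : 2 * z.re = x := by
    have : z.im * (2 * z.re - x) = 0 := by linear_combination him
    rcases mul_eq_zero.1 this with h | h
    · exact absurd h hy
    · linarith
  rw [← sq_eq_sq₀ (norm_nonneg z) zero_le_one, ← Complex.normSq_eq_norm_sq, Complex.normSq_apply]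
  rw [← hx] at hre
  linarith

theorem exists_norm_eq_one_add_inv_eq {x : ℝ} (h1 : -2 < x) (h2 : x < 2) :
    ∃ z : ℂ, ‖z‖ = 1 ∧ z + z⁻¹ = x := by
  obtain ⟨z, hz⟩ := IsAlgClosed.exists_root (X ^ 2 - C (x : ℂ) * X + 1 : ℂ[X]) (by
    have : (X ^ 2 - C (x : ℂ) * X + 1 : ℂ[X]).degree = 2 := by compute_degree!
    rw [this]; norm_num)
  simp at hz
  have h0 : z ≠ 0 := by
    rintro rfl
    simp at hz
  have h : z + z⁻¹ = x := by
    field_simp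
    linear_combination hz
  exact ⟨z, norm_eq_one_of_add_inv_eq h0 h1 h2 h, h⟩

theorem exists_add_inv_eq_of_two_lt {β : ℝ} (h : 2 < β) : ∃ α : ℝ, 1 < α ∧ α + α⁻¹ = β := by
  have hs := Real.sq_sqrt (show (0 : ℝ) ≤ β ^ 2 - 4 by nlinarith)
  have hp := Real.sqrt_nonneg (β ^ 2 - 4)
  refine ⟨(β + √(β ^ 2 - 4)) / 2, by linarith, ?_⟩
  have : (β + √(β ^ 2 - 4)) / 2 ≠ 0 := by linarith
  field_simp
  linear_combination hs

/-! ### From a trace polynomial to a Salem number. -/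

namespace IsSalemTrace

variable {R : ℤ[X]} {β α : ℝ}

theorem aeval_traceLift_eq_zero (h : IsSalemTrace R β) (h1 : 1 < α) (hα : α + α⁻¹ = β) :
    aeval α (traceLift R) = 0 := by
  rw [aeval_traceLift R (by linarith), hα, h.root, mul_zero]

theorem norm_le_one (h : IsSalemTrace R β) (h1 : 1 < α) (hα : α + α⁻¹ = β) {z : ℂ}
    (hz : aeval z (traceLift R) = 0) (hne : z ≠ α) : ‖z‖ ≤ 1 := by
  have hz0 : z ≠ 0 := by
    rintro rfl
    rw [aeval_zero_traceLift h.monic] at hz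
    exact one_ne_zero hz
  rw [aeval_traceLift R hz0, mul_eq_zero, or_iff_right (pow_ne_zero _ hz0)] at hz
  by_cases hb : z + z⁻¹ = β
  · have hα0 : (α : ℂ) ≠ 0 := by exact_mod_cast (by linarith : α ≠ 0)
    rw [← hα] at hb
    push_cast at hb
    have : (z - α) * (z * α - 1) = 0 := by
      field_simp at hb
      linear_combination hb
    rcases mul_eq_zero.1 this with h | h
    · exact absurd (sub_eq_zero.1 h) hne
    · have hz : z = (α : ℂ)⁻¹ := eq_inv_of_mul_eq_one_left (sub_eq_zero.1 h)
      rw [hz, norm_inv, Complex.norm_real, Real.norm_of_nonneg (by linarith)]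
      exact inv_le_one_of_one_le₀ h1.le
  · obtain ⟨x, hx1, hx2, hx⟩ := h.others _ hz hb
    exact (norm_eq_one_of_add_inv_eq hz0 hx1 hx2 hx).le

/-- The chain rule multiplies the nonzero derivative at `β` by `1 - α⁻²`, nonzero as `α > 1`. This
keeps `α` from being a root of the cofactor of its minimal polynomial. -/
theorem aeval_derivative_traceLift_ne_zero (h : IsSalemTrace R β) (h1 : 1 < α)
    (hα : α + α⁻¹ = β) : aeval α (derivative (traceLift R)) ≠ 0 := by
  have hα0 : α ≠ 0 := by linarith
  have hd1 := (traceLift R).hasDerivAt_aeval α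
  have hg : HasDerivAt (fun z : ℝ => z + z⁻¹) (1 + -(α ^ 2)⁻¹) α :=
    (hasDerivAt_id α).add (hasDerivAt_inv hα0)
  have hd2 := (hasDerivAt_pow R.natDegree α).mul
    (HasDerivAt.comp α (by simpa only [hα] using R.hasDerivAt_aeval (α + α⁻¹)) hg)
  have heq := (hd1.congr_of_eventuallyEq (f₁ := (fun z : ℝ => z ^ R.natDegree) *
    ((fun y => aeval y R) ∘ fun z : ℝ => z + z⁻¹)) (by
      filter_upwards [isOpen_ne.mem_nhds hα0] with z hz
      exact (aeval_traceLift R hz).symm)).unique hd2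
  rw [heq]
  simp only [Function.comp, hα, h.root, mul_zero, zero_add]
  refine mul_ne_zero (pow_ne_zero _ hα0) (mul_ne_zero h.simple ?_)
  have : 1 < α ^ 2 := by nlinarith
  have := inv_lt_one_of_one_lt₀ this
  linarith

theorem isIntegral (h : IsSalemTrace R β) (h1 : 1 < α) (hα : α + α⁻¹ = β) : IsIntegral ℤ α :=
  ⟨traceLift R, (monic_traceLift_and_natDegree h.monic).1, h.aeval_traceLift_eq_zero h1 hα⟩

/-- Either `traceLift R` is the minimal polynomial of `α`, which is then a Salem number, or it has a
root in the finite set of `finite_roots_in_unit_disc`. -/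
theorem isSalemNumber_or (h : IsSalemTrace R β) (h1 : 1 < α) (hα : α + α⁻¹ = β) :
    (IsSalemNumber α ∧ (minpoly ℚ α).natDegree = 2 * R.natDegree) ∨
      ∃ z : ℂ, aeval z (traceLift R) = 0 ∧ ∃ Q : ℤ[X], Q.Monic ∧
        Q.natDegree ≤ 2 * R.natDegree ∧ (∀ w : ℂ, aeval w Q = 0 → ‖w‖ ≤ 1) ∧ aeval z Q = 0 := by
  obtain ⟨hm, hd⟩ := monic_traceLift_and_natDegree h.monic
  have hroot := h.aeval_traceLift_eq_zero h1 hα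
  have hint := h.isIntegral h1 hα
  have hPm := minpoly.monic hint
  obtain ⟨Q, hQ⟩ := minpoly.isIntegrallyClosed_dvd hint hroot
  have hQm : Q.Monic := hPm.of_mul_monic_left (hQ ▸ hm)
  have hdeg : (minpoly ℤ α).natDegree + Q.natDegree = 2 * R.natDegree := by
    rw [← hPm.natDegree_mul hQm, ← hQ, hd]
  by_cases hQ0 : Q.natDegree = 0
  · left
    have hQ1 : Q = 1 := hQm.natDegree_eq_zero.1 hQ0
    rw [hQ1, mul_one] at hQ
    have hmin := minpoly.isIntegrallyClosed_eq_field_fractions' ℚ hint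
    have hae : ∀ z : ℂ, aeval z (minpoly ℚ α) = aeval z (traceLift R) := fun z => by
      rw [hmin, aeval_map_algebraMap, hQ]
    refine ⟨⟨hint, h1, fun z hz hne => h.norm_le_one h1 hα (by rwa [← hae]) hne, ?_⟩, ?_⟩
    · obtain ⟨x, hx1, hx2, hx⟩ := h.exists_root
      obtain ⟨z, hz, hzx⟩ := exists_norm_eq_one_add_inv_eq hx1 hx2
      refine ⟨z, ?_, hz⟩
      rw [hae, aeval_traceLift R (by rintro rfl; simp at hz), hzx]
      have : aeval (x : ℂ) R = ((aeval x R : ℝ) : ℂ) := aeval_algebraMap_apply ℂ x R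
      rw [this, hx]
      simp
    · rw [hmin, hPm.natDegree_map, ← hQ, hd]
  · right
    have hQα : aeval α Q ≠ 0 := fun h0 => by
      apply h.aeval_derivative_traceLift_ne_zero h1 hα
      rw [hQ, derivative_mul, map_add, map_mul, map_mul, minpoly.aeval, h0]
      simp
    obtain ⟨z, hz⟩ := IsAlgClosed.exists_aeval_eq_zero ℂ (Q.map (algebraMap ℤ ℚ)) (by
      rw [degree_eq_natDegree (hQm.map _).ne_zero, hQm.natDegree_map]
      exact_mod_cast hQ0)
    rw [aeval_map_algebraMap] at hz
    refine ⟨z, by rw [hQ, map_mul, hz, mul_zero], Q, hQm, by omega, fun w hw => ?_, hz⟩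
    refine h.norm_le_one h1 hα (by rw [hQ, map_mul, hw, mul_zero]) ?_
    rintro rfl
    apply hQα
    have : aeval (α : ℂ) Q = ((aeval α Q : ℝ) : ℂ) := aeval_algebraMap_apply ℂ α Q
    rw [this] at hw
    exact_mod_cast hw

end IsSalemTrace

/-! ### Chebyshev polynomials and the unit condition. -/

theorem isAlgebraicUnit_of_mul_eq_one {x y : ℝ} (hx : IsIntegral ℤ x) (hy : IsIntegral ℤ y)
    (h : x * y = 1) : IsAlgebraicUnit x :=
  ⟨⟨⟨x, hx⟩, ⟨y, hy⟩, Subtype.ext h, Subtype.ext ((mul_comm y x).trans h)⟩, rfl⟩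

theorem sub_inv_mul_eval_chebyshevS {K : Type*} [Field K] {z : K} (hz : z ≠ 0) (n : ℕ) :
    (z - z⁻¹) * (Chebyshev.S K n).eval (z + z⁻¹) = z ^ (n + 1) - z⁻¹ ^ (n + 1) := by
  induction n using Nat.twoStepInduction with
  | zero => simp
  | one => simp; ring
  | more n h0 h1 =>
    have : Chebyshev.S K ((n + 2 : ℕ) : ℤ) =
        X * Chebyshev.S K ((n + 1 : ℕ) : ℤ) - Chebyshev.S K (n : ℤ) := by
      push_cast
      exact Chebyshev.S_add_two K n
    rw [this, eval_sub, eval_mul, eval_X]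
    have hzz : z * z⁻¹ = 1 := mul_inv_cancel₀ hz
    linear_combination (z + z⁻¹) * h1 - h0 + (z ^ (n + 1) - z⁻¹ ^ (n + 1)) * hzz

theorem monic_chebyshevS_and_natDegree (n : ℕ) :
    (Chebyshev.S ℤ n).Monic ∧ (Chebyshev.S ℤ n).natDegree = n := by
  induction n using Nat.twoStepInduction with
  | zero => simp
  | one => simp [monic_X]
  | more n h0 h1 =>
    have : Chebyshev.S ℤ ((n + 2 : ℕ) : ℤ) =
        X * Chebyshev.S ℤ ((n + 1 : ℕ) : ℤ) - Chebyshev.S ℤ (n : ℤ) := by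
      push_cast
      exact Chebyshev.S_add_two ℤ n
    have hm : (X * Chebyshev.S ℤ ((n + 1 : ℕ) : ℤ)).Monic := monic_X.mul h1.1
    have hd : (X * Chebyshev.S ℤ ((n + 1 : ℕ) : ℤ)).natDegree = n + 2 := by
      rw [monic_X.natDegree_mul h1.1, h1.2, natDegree_X]; ring
    have hlt : (Chebyshev.S ℤ (n : ℤ)).degree < (X * Chebyshev.S ℤ ((n + 1 : ℕ) : ℤ)).degree := by
      rw [degree_eq_natDegree hm.ne_zero, degree_eq_natDegree h0.1.ne_zero, hd, h0.2]
      exact_mod_cast (by omega : n < n + 2)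
    rw [this]
    exact ⟨hm.sub_of_left hlt, by rw [natDegree_sub_eq_left_of_natDegree_lt (by omega), hd]⟩

/-- The polynomial vanishing at `z + z⁻¹` for all `z` with `z ^ (2 * (k + 1)) = 1`. -/
noncomputable def cyclicFactor (k : ℕ) : ℤ[X] := (X ^ 2 - C 4) * Chebyshev.S ℤ k

theorem monic_cyclicFactor (k : ℕ) : (cyclicFactor k).Monic :=
  (monic_X_pow_sub_C 4 two_ne_zero).mul (monic_chebyshevS_and_natDegree k).1

theorem natDegree_cyclicFactor (k : ℕ) : (cyclicFactor k).natDegree = k + 2 := by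
  rw [cyclicFactor, (monic_X_pow_sub_C 4 two_ne_zero).natDegree_mul
    (monic_chebyshevS_and_natDegree k).1, natDegree_X_pow_sub_C,
    (monic_chebyshevS_and_natDegree k).2, add_comm]

theorem aeval_cyclicFactor {K : Type*} [Field K] (k : ℕ) (x : K) :
    aeval x (cyclicFactor k) = (x ^ 2 - 4) * (Chebyshev.S K k).eval x := by
  simp [cyclicFactor, map_ofNat]

/-- If `cyclicFactor k` divides `1` at the trace of `α`, then `α ^ (2 * (k + 1)) - 1` is a unit. -/
theorem isAlgebraicUnit_pow_sub_one {α : ℝ} (hα0 : α ≠ 0) (hα : IsIntegral ℤ α)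
    (hα' : IsIntegral ℤ α⁻¹) (k : ℕ) {G : ℤ[X]}
    (h : aeval (α + α⁻¹) (cyclicFactor k * G) = 1) :
    IsAlgebraicUnit (α ^ (2 * (k + 1)) - 1) := by
  set β := α + α⁻¹ with hβdef
  have hβ : IsIntegral ℤ β := hα.add hα'
  have hG : IsIntegral ℤ (aeval β G) :=
    adjoin_le_integralClosure hβ (aeval_mem_adjoin_singleton ℤ β)
  have hx : IsIntegral ℤ (α ^ (2 * (k + 1)) - 1) := (hα.pow _).sub isIntegral_one
  have h4 : IsIntegral ℤ (β ^ 2 - 4) := 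
    (hβ.pow 2).sub (by simpa using isIntegral_algebraMap (R := ℤ) (A := ℝ) (x := 4))
  -- Squaring removes `α - α⁻¹`: `(α ^ n - 1) ^ 2 * α⁻¹ ^ n = (β ^ 2 - 4) * S_k(β) ^ 2` with `n = 2
  -- * (k + 1)`, and the factor `(β ^ 2 - 4) * G(β) ^ 2` turns this into `1`.
  refine isAlgebraicUnit_of_mul_eq_one hx (((hx.mul (hα'.pow (2 * (k + 1)))).mul h4).mul
    (hG.pow 2)) ?_
  rw [map_mul, aeval_cyclicFactor] at h
  have hS := sub_inv_mul_eval_chebyshevS hα0 k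
  rw [← hβdef] at hS
  have hzz : α * α⁻¹ = 1 := mul_inv_cancel₀ hα0
  have hpow : α ^ (k + 1) * α⁻¹ ^ (k + 1) = 1 := by rw [← mul_pow, hzz, one_pow]
  have h1 : α ^ (2 * (k + 1)) - 1 = α ^ (k + 1) * ((α - α⁻¹) * (Chebyshev.S ℝ k).eval β) := by
    rw [hS, two_mul, pow_add]; linear_combination hpow
  have h2 : (α - α⁻¹) ^ 2 = β ^ 2 - 4 := by rw [hβdef]; linear_combination (-4) * hzz
  rw [h1, two_mul, pow_add α⁻¹]
  set s := (Chebyshev.S ℝ k).eval β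
  set g := aeval β G
  set u := α ^ (k + 1)
  set v := α⁻¹ ^ (k + 1)
  calc u * ((α - α⁻¹) * s) * (u * ((α - α⁻¹) * s) * (v * v) * (β ^ 2 - 4) * g ^ 2)
      = (u * v) ^ 2 * ((α - α⁻¹) ^ 2 * s ^ 2 * (β ^ 2 - 4) * g ^ 2) := by ring
    _ = ((β ^ 2 - 4) * s * g) ^ 2 := by rw [hpow, h2]; ring
    _ = 1 := by rw [h, one_pow]

/-! ### The one-parameter family of trace polynomials. -/

/-- An integer polynomial with the `d` roots `2 - (i + 1) / N`, for `i < d`. -/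
noncomputable def rationalFactor (d N : ℕ) : ℤ[X] :=
  ∏ i ∈ Finset.range d, (C (N : ℤ) * (X - C 2) + C ((i : ℤ) + 1))

theorem aeval_rationalFactor {K : Type*} [Field K] (d N : ℕ) (x : K) :
    aeval x (rationalFactor d N) = ∏ i ∈ Finset.range d, ((N : K) * (x - 2) + (i + 1)) := by
  simp [rationalFactor, map_prod, map_ofNat]

theorem natDegree_rationalFactor_le (d N : ℕ) : (rationalFactor d N).natDegree ≤ d := by
  refine (natDegree_prod_le _ _).trans ((Finset.sum_le_card_nsmul _ _ 1 fun i _ => ?_).trans ?_)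
  · compute_degree
  · simp

/-- For `d < N` the roots of `rationalFactor d N` are rational but not integral. -/
theorem aeval_rationalFactor_ne_zero {K : Type*} [Field K] [CharZero K] {d N : ℕ} (hN : d < N)
    {x : K} (hx : IsIntegral ℤ x) : aeval x (rationalFactor d N) ≠ 0 := by
  rw [aeval_rationalFactor, Finset.prod_ne_zero_iff]
  intro i hi h0
  have hi := Finset.mem_range.1 hi
  have h2 : IsIntegral ℤ (2 - x) :=
    IsIntegral.sub (by simpa using isIntegral_algebraMap (R := ℤ) (A := K) (x := 2)) hx
  have hN0 : (N : K) ≠ 0 := by exact_mod_cast (by omega : N ≠ 0)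
  have hq : (2 - x : K) = algebraMap ℚ K ((i + 1) / N) := by
    simp only [map_div₀, map_add, map_natCast, map_one]
    field_simp
    linear_combination -h0
  rw [hq, isIntegral_algebraMap_iff (algebraMap ℚ K).injective,
    IsIntegrallyClosed.isIntegral_iff] at h2
  obtain ⟨c, hc⟩ := h2
  rw [eq_div_iff (by exact_mod_cast (by omega : N ≠ 0))] at hc
  have hc' : c * N = i + 1 := by
    simp only [eq_intCast] at hc
    exact_mod_cast hc
  have : (N : ℤ) ≤ i + 1 := Int.le_of_dvd (by omega) ⟨c, by rw [← hc', mul_comm]⟩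
  omega

theorem neg_one_pow_mul_prod_pos {c : ℕ → ℝ} {d s : ℕ} (hs : s ≤ d) (hneg : ∀ i < s, c i < 0)
    (hpos : ∀ i, s ≤ i → i < d → 0 < c i) : 0 < (-1) ^ s * ∏ i ∈ Finset.range d, c i := by
  rw [← Finset.prod_range_mul_prod_Ico c hs, ← mul_assoc]
  refine mul_pos ?_ (Finset.prod_pos fun i hi => ?_)
  · have : (-1 : ℝ) ^ s * ∏ i ∈ Finset.range s, c i = ∏ i ∈ Finset.range s, -c i := by
      rw [Finset.prod_neg, Finset.card_range]
    rw [this]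
    exact Finset.prod_pos fun i hi => neg_pos.2 (hneg i (Finset.mem_range.1 hi))
  · have := Finset.mem_Ico.1 hi
    exact hpos i this.1 this.2

/-- The trace polynomials from which the Salem numbers are built. -/
noncomputable def tracePoly (k d N a : ℕ) : ℤ[X] :=
  cyclicFactor k * (X ^ (d + 1) - C (a : ℤ) * rationalFactor d N) - 1

theorem monic_tracePoly_and_natDegree (k d N a : ℕ) :
    (tracePoly k d N a).Monic ∧ (tracePoly k d N a).natDegree = k + d + 3 := by
  have hle : (C (a : ℤ) * rationalFactor d N).natDegree < d + 1 :=
    ((natDegree_C_mul_le _ _).trans (natDegree_rationalFactor_le d N)).trans_lt (Nat.lt_succ_self d)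
  have hG : (X ^ (d + 1) - C (a : ℤ) * rationalFactor d N : ℤ[X]).Monic :=
    (monic_X_pow _).sub_of_left (by
      rw [degree_X_pow]
      exact (degree_lt_iff_coeff_zero _ _).2 fun j hj =>
        coeff_eq_zero_of_natDegree_lt (hle.trans_le hj))
  have hGd : (X ^ (d + 1) - C (a : ℤ) * rationalFactor d N : ℤ[X]).natDegree = d + 1 := by
    rw [natDegree_sub_eq_left_of_natDegree_lt (by rwa [natDegree_X_pow]), natDegree_X_pow]
  have hP := (monic_cyclicFactor k).mul hG
  have hPd : (cyclicFactor k * (X ^ (d + 1) - C (a : ℤ) * rationalFactor d N)).natDegree =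
      k + d + 3 := by
    rw [(monic_cyclicFactor k).natDegree_mul hG, hGd, natDegree_cyclicFactor]; ring
  constructor
  · refine hP.sub_of_left ?_
    rw [degree_one, degree_eq_natDegree hP.ne_zero, hPd]
    exact_mod_cast (by omega : 0 < k + d + 3)
  · rw [tracePoly, natDegree_sub_eq_left_of_natDegree_lt (by rw [hPd, natDegree_one]; omega), hPd]

theorem aeval_tracePoly {K : Type*} [Field K] (k d N a : ℕ) (x : K) :
    aeval x (tracePoly k d N a) = aeval x (cyclicFactor k) *
      (x ^ (d + 1) - a * aeval x (rationalFactor d N)) - 1 := by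
  simp [tracePoly]

/-- A number is a root of `tracePoly k d N a` for at most one `a`. -/
theorem tracePoly_param_unique {K : Type*} [Field K] [CharZero K] {k d N a b : ℕ} (hN : d < N)
    {x : K} (ha : aeval x (tracePoly k d N a) = 0) (hb : aeval x (tracePoly k d N b) = 0) :
    a = b := by
  have hx : IsIntegral ℤ x := ⟨_, (monic_tracePoly_and_natDegree k d N a).1, ha⟩
  rw [aeval_tracePoly] at ha hb
  have hE : aeval x (cyclicFactor k) ≠ 0 := fun h => by simp [h] at ha
  have : aeval x (cyclicFactor k) * aeval x (rationalFactor d N) * ((a : K) - b) = 0 := by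
    linear_combination hb - ha
  have := (mul_eq_zero.1 this).resolve_left (mul_ne_zero hE (aeval_rationalFactor_ne_zero hN hx))
  exact_mod_cast sub_eq_zero.1 this

/-! ### Sign patterns on `[-2, 2]`. -/

theorem aeval_cyclicFactor_two_mul_cos (k : ℕ) (θ : ℝ) :
    aeval (2 * Real.cos θ) (cyclicFactor k) = -4 * (Real.sin θ * Real.sin ((k + 1) * θ)) := by
  have h := Chebyshev.S_two_mul_real_cos θ k
  have hs := Real.sin_sq_add_cos_sq θ
  rw [aeval_cyclicFactor]
  push_cast at h
  rw [← h]
  linear_combination 4 * (Chebyshev.S ℝ k).eval (2 * Real.cos θ) * hs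

/-- Between consecutive zeros in `(-2, 2)` of `cyclicFactor k` the signs alternate. -/
theorem cyclicFactor_sign_at_cos {k i : ℕ} (hk : Odd k) (hi : 1 ≤ i) (hik : i ≤ k) :
    0 < (-1) ^ (i + 1) * aeval (-2 * Real.cos ((i - 1 / 2) * (Real.pi / (k + 1))))
      (cyclicFactor k) := by
  set φ := ((i : ℝ) - 1 / 2) * (Real.pi / (k + 1)) with hφ
  have hi' : (1 : ℝ) ≤ i := by exact_mod_cast hi
  have hik' : (i : ℝ) ≤ k := by exact_mod_cast hik
  have hpi := Real.pi_pos
  have hk0 : (0 : ℝ) < k + 1 := by positivity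
  have hcos : -2 * Real.cos φ = 2 * Real.cos (Real.pi - φ) := by rw [Real.cos_pi_sub]; ring
  have hφk : (k + 1) * φ = i * Real.pi - Real.pi / 2 := by rw [hφ]; field_simp
  have hsin : 0 < Real.sin φ := by
    refine Real.sin_pos_of_pos_of_lt_pi (mul_pos (by linarith) (by positivity)) ?_
    have : (k + 1) * φ < (k + 1) * Real.pi := by rw [hφk]; nlinarith
    exact lt_of_mul_lt_mul_left this hk0.le
  have hsin2 : Real.sin ((k + 1) * (Real.pi - φ)) = (-1) ^ i := by
    obtain ⟨l, hl⟩ := hk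
    have h1 : ((k : ℝ) + 1) * (Real.pi - φ) =
        (Real.pi / 2 - i * Real.pi) + ((l + 1 : ℕ) : ℝ) * (2 * Real.pi) := by
      rw [mul_sub, hφk, hl]; push_cast; ring
    rw [h1, Real.sin_add_nat_mul_two_pi, Real.sin_pi_div_two_sub, Real.cos_nat_mul_pi]
  rw [hcos, aeval_cyclicFactor_two_mul_cos, hsin2, Real.sin_pi_sub]
  have : (-1 : ℝ) ^ (i + 1) * (-4 * (Real.sin φ * (-1) ^ i)) =
      4 * Real.sin φ * ((-1) ^ i * (-1) ^ i) := by ring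
  rw [this, ← mul_pow]
  norm_num
  exact hsin

/-- For large `N`, the product `cyclicFactor k * rationalFactor d N` has alternating signs along
`k + d + 1` increasing points of `(-2, 2)`. -/
theorem exists_alternating_points {k d : ℕ} (hk : Odd k) (hd : Odd d) :
    ∃ N > d, ∃ x : ℕ → ℝ, x 0 = -2 ∧ x (k + d + 2) = 2 ∧
      (∀ i < k + d + 2, x i < x (i + 1)) ∧
      ∀ i, 1 ≤ i → i ≤ k + d + 1 → 0 < (-1) ^ i *
        (aeval (x i) (cyclicFactor k) * aeval (x i) (rationalFactor d N)) := by
  -- Angular midpoints between consecutive zeros of `E`. Only the first `k` of the `k + 1` gaps are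
  -- used; the last one, ending at `2`, receives the points `q s` instead.
  set y : ℕ → ℝ := fun i => -2 * Real.cos ((i - 1 / 2) * (Real.pi / (k + 1))) with hy
  have hpi := Real.pi_pos
  have hk0 : (0 : ℝ) < k + 1 := by positivity
  have hk1 : 1 ≤ k := hk.pos
  have hang : ∀ i : ℕ, i ≤ k → ((i : ℝ) - 1 / 2) * (Real.pi / (k + 1)) < Real.pi := fun i hi => by
    have : (i : ℝ) ≤ k := by exact_mod_cast hi
    rw [mul_div_assoc', div_lt_iff₀ hk0]
    nlinarith
  have hang0 : ∀ i : ℕ, 1 ≤ i → 0 < ((i : ℝ) - 1 / 2) * (Real.pi / (k + 1)) := fun i hi => by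
    have : (1 : ℝ) ≤ i := by exact_mod_cast hi
    exact mul_pos (by linarith) (by positivity)
  have hymono : ∀ i j : ℕ, 1 ≤ i → i < j → j ≤ k → y i < y j := fun i j hi hij hj => by
    have h : (i : ℝ) < j := by exact_mod_cast hij
    have := Real.cos_lt_cos_of_nonneg_of_le_pi (hang0 i hi).le (hang j hj).le
      (mul_lt_mul_of_pos_right (sub_lt_sub_right h (1 / 2)) (by positivity))
    simp only [hy]; linarith
  have hylt : y k < 2 := by
    have := Real.cos_lt_cos_of_nonneg_of_le_pi (hang0 k hk1).le le_rfl (hang k le_rfl)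
    rw [Real.cos_pi] at this
    simp only [hy]; linarith
  have hygt : -2 < y 1 := by
    have := Real.cos_lt_cos_of_nonneg_of_le_pi le_rfl (hang 1 hk1).le (hang0 1 le_rfl)
    rw [Real.cos_zero] at this
    simp only [hy]; linarith
  have htend : ∀ s : ℕ, Tendsto (fun N : ℕ => 2 - ((s : ℝ) + 1 / 2) / N) atTop (𝓝 2) := fun s => by
    simpa using tendsto_const_nhds.sub (tendsto_const_div_atTop_nhds_zero_nat ((s : ℝ) + 1 / 2))
  -- `S_k(2) = k + 1 > 0`, so for large `N` the points near `2` all see the same sign of `E`.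
  have hS : ∀ s : ℕ, ∀ᶠ N : ℕ in atTop,
      0 < (Chebyshev.S ℝ k).eval (2 - ((s : ℝ) + 1 / 2) / N) := fun s => by
    have hc : Tendsto (fun z => (Chebyshev.S ℝ k).eval z) (𝓝 2) (𝓝 ((k : ℝ) + 1)) := by
      have := (Chebyshev.S ℝ k).continuous.tendsto 2
      rwa [Chebyshev.S_eval_two, Int.cast_natCast] at this
    exact (hc.comp (htend s)).eventually_const_lt hk0
  have hS' : ∀ᶠ N : ℕ in atTop, ∀ s ∈ Finset.range (d + 1),
      0 < (Chebyshev.S ℝ k).eval (2 - ((s : ℝ) + 1 / 2) / N) :=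
    (Filter.eventually_all_finset _).2 fun s _ => hS s
  have hylt' : ∀ᶠ N : ℕ in atTop, max (y k) (-2) < 2 - ((d : ℝ) + 1 / 2) / N :=
    (htend d).eventually_const_lt (max_lt hylt (by norm_num))
  obtain ⟨N, hNd, hNS, hNy⟩ := ((eventually_gt_atTop d).and (hS'.and hylt')).exists
  obtain ⟨hNy, hN2⟩ := max_lt_iff.1 hNy
  have hN0 : (0 : ℝ) < N := by exact_mod_cast (by omega : 0 < N)
  set q : ℕ → ℝ := fun s => 2 - ((s : ℝ) + 1 / 2) / N with hq
  have hqmono : ∀ s r : ℕ, s < r → q r < q s := fun s r h => by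
    have h : (s : ℝ) < r := by exact_mod_cast h
    exact sub_lt_sub_left (div_lt_div_of_pos_right (by linarith) hN0) 2
  have hqlt : ∀ s, q s < 2 := fun s => sub_lt_self 2 (by positivity)
  -- The `q s` interlace the roots of `H` but decrease in `s`, hence the reversed index.
  set x : ℕ → ℝ := fun i => if i = 0 then -2 else if i ≤ k then y i else
    if i ≤ k + 1 + d then q (k + 1 + d - i) else 2 with hxdef
  have hx0 : x 0 = -2 := by simp [hxdef]
  have hxy : ∀ i, 1 ≤ i → i ≤ k → x i = y i := fun i h1 h2 => by
    simp only [hxdef]; rw [if_neg (by omega), if_pos h2]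
  have hxq : ∀ i, k < i → i ≤ k + 1 + d → x i = q (k + 1 + d - i) := fun i h1 h2 => by
    simp only [hxdef]; rw [if_neg (by omega), if_neg (by omega), if_pos h2]
  have hx2 : x (k + d + 2) = 2 := by
    simp only [hxdef]; rw [if_neg (by omega), if_neg (by omega), if_neg (by omega)]
  refine ⟨N, hNd, x, hx0, hx2, ?_, ?_⟩
  · intro i hi
    rcases Nat.eq_zero_or_pos i with rfl | hi0
    · rw [hx0, hxy _ le_rfl hk1]; exact hygt
    rcases lt_trichotomy i k with h | rfl | h
    · rw [hxy _ hi0 h.le, hxy _ (by omega) h]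
      exact hymono _ _ hi0 (Nat.lt_succ_self i) h
    · rw [hxy _ hi0 le_rfl, hxq _ (by omega) (by omega), Nat.add_sub_cancel_left]
      exact hNy
    · by_cases h' : i = k + d + 1
      · rw [h', hx2, hxq _ (by omega) (by omega)]; exact hqlt _
      · rw [hxq _ h (by omega), hxq _ (by omega) (by omega)]
        exact hqmono _ _ (by omega)
  · intro i hi1 hi2
    by_cases hik : i ≤ k
    · rw [hxy i hi1 hik]
      have hE := cyclicFactor_sign_at_cos hk hi1 hik
      have hyi : y i < 2 - ((d : ℝ) + 1 / 2) / N := by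
        rcases hik.lt_or_eq with h | rfl
        · exact (hymono i k hi1 h le_rfl).trans hNy
        · exact hNy
      have hmul : (N : ℝ) * (y i - 2) < -(d + 1 / 2) := by
        rw [lt_sub_iff_add_lt, ← lt_sub_iff_add_lt', div_lt_iff₀ hN0] at hyi
        linarith
      have hH := neg_one_pow_mul_prod_pos (c := fun j : ℕ => (N : ℝ) * (y i - 2) + (j + 1))
        (le_refl d) (fun j hj => by
          have : (j : ℝ) + 1 ≤ d := by exact_mod_cast hj
          linarith) (fun j h1 h2 => absurd h2 (by omega))
      -- `y i` lies to the left of all `d` roots of `H`, and `d` is odd, so `H` is negative there.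
      rw [← aeval_rationalFactor, hd.neg_one_pow] at hH
      have := mul_pos hE hH
      rw [pow_succ] at this
      linarith
    · push Not at hik
      obtain ⟨s, hs, rfl⟩ : ∃ s ≤ d, i = k + 1 + d - s := ⟨k + 1 + d - i, by omega, by omega⟩
      rw [hxq _ hik (by omega), show k + 1 + d - (k + 1 + d - s) = s by omega]
      have hE : aeval (q s) (cyclicFactor k) < 0 := by
        rw [aeval_cyclicFactor]
        refine mul_neg_of_neg_of_pos ?_ (hNS s (Finset.mem_range.2 (by omega)))
        have h1 := hqlt s
        have h2 : -2 < q s := by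
          rcases hs.lt_or_eq with h | rfl
          · exact hN2.trans (hqmono s d h)
          · exact hN2
        nlinarith
      have hmul : (N : ℝ) * (q s - 2) = -(s + 1 / 2) := by simp only [hq]; field_simp; ring
      have hH := neg_one_pow_mul_prod_pos (c := fun j : ℕ => (N : ℝ) * (q s - 2) + (j + 1)) hs
        (fun j hj => by
          have : (j : ℝ) + 1 ≤ s := by exact_mod_cast hj
          rw [hmul]; linarith)
        (fun j h1 h2 => by
          have : (s : ℝ) ≤ j := by exact_mod_cast h1
          rw [hmul]; linarith)
      rw [← aeval_rationalFactor] at hH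
      have hpow : (-1 : ℝ) ^ (k + 1 + d - s) = -(-1) ^ s := by
        have h1 : (-1 : ℝ) ^ (k + 1 + d - s) * (-1) ^ s = -1 := by
          rw [← pow_add, Nat.sub_add_cancel (by omega)]
          exact (hk.add_one.add_odd hd).neg_one_pow
        have h2 : (-1 : ℝ) ^ s * (-1) ^ s = 1 := by rw [← mul_pow]; norm_num
        linear_combination (-1 : ℝ) ^ s * h1 - (-1 : ℝ) ^ (k + 1 + d - s) * h2
      rw [hpow]
      have := mul_pos (neg_pos.2 hE) hH
      linarith

/-- `tracePoly k d N a` is a Salem trace polynomial for all large `a`. -/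
theorem eventually_isSalemTrace {k d : ℕ} (hk : Odd k) (hd : Odd d) :
    ∃ N > d, ∀ᶠ a : ℕ in atTop, ∃ β, IsSalemTrace (tracePoly k d N a) β := by
  obtain ⟨N, hN, x, hx0, hx2, hx, hsign⟩ := exists_alternating_points hk hd
  refine ⟨N, hN, ?_⟩
  -- The term `-a * E * H` dominates at these finitely many points, whence the shift of the exponent
  -- by one.
  have hev : ∀ᶠ a : ℕ in atTop, ∀ i ∈ Finset.Icc 1 (k + d + 1),
      0 < (-1) ^ (i + 1) * aeval (x i) (tracePoly k d N a) := by
    refine (Filter.eventually_all_finset _).2 fun i hi => ?_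
    have hi := Finset.mem_Icc.1 hi
    have hpos := hsign i hi.1 hi.2
    have := (tendsto_natCast_atTop_atTop (R := ℝ)).const_mul_atTop hpos
    filter_upwards [this.eventually_gt_atTop
      ((-1) ^ i * (aeval (x i) (cyclicFactor k) * x i ^ (d + 1) - 1))] with a ha
    rw [aeval_tracePoly, pow_succ]
    linarith
  filter_upwards [hev] with a ha
  obtain ⟨hm, hdeg⟩ := monic_tracePoly_and_natDegree k d N a
  have htop : Tendsto (fun y : ℝ => aeval y (tracePoly k d N a)) atTop atTop := by
    have := ((tracePoly k d N a).map (algebraMap ℤ ℝ)).tendsto_atTop_of_leadingCoeff_nonneg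
      (by rw [degree_eq_natDegree (hm.map _).ne_zero, hm.natDegree_map, hdeg]
          exact_mod_cast (by omega : 0 < k + d + 3))
      (by rw [(hm.map _).leadingCoeff]; exact zero_le_one)
    simpa only [eval_map_algebraMap] using this
  obtain ⟨M, hM2, hM⟩ := ((eventually_gt_atTop 2).and (htop.eventually_gt_atTop 0)).exists
  set x' : ℕ → ℝ := fun i => if i ≤ k + d + 2 then x i else M with hx'
  have hx'x : ∀ i ≤ k + d + 2, x' i = x i := fun i hi => if_pos hi
  have hx'M : x' (k + d + 3) = M := if_neg (by omega)
  have heven : Even (k + d + 2) := (hk.add_odd hd).add even_two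
  have hall : ∀ i ≤ k + d + 3, 0 < (-1) ^ (i + 1) * aeval (x' i) (tracePoly k d N a) := by
    intro i hi
    have hE : ∀ y : ℝ, y ^ 2 = 4 → aeval y (tracePoly k d N a) = -1 := fun y hy => by
      rw [aeval_tracePoly, aeval_cyclicFactor, hy]; ring
    rcases Nat.eq_zero_or_pos i with rfl | hi0
    · rw [hx'x 0 (by omega), hx0, hE _ (by norm_num)]; norm_num
    rcases Nat.lt_or_ge i (k + d + 2) with h | h
    · rw [hx'x i h.le]
      exact ha i (Finset.mem_Icc.2 ⟨hi0, by omega⟩)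
    obtain rfl | rfl : i = k + d + 2 ∨ i = k + d + 3 := by omega
    · rw [hx'x _ le_rfl, hx2, hE _ (by norm_num), heven.add_one.neg_one_pow]; norm_num
    · rw [hx'M, show k + d + 3 + 1 = k + d + 2 + 2 by ring, (heven.add even_two).neg_one_pow,
        one_mul]
      exact hM
  refine exists_isSalemTrace_of_alternating hm (by omega) hdeg x' ?_ ?_ ?_ ?_
  · intro i hi
    rcases Nat.lt_or_ge i (k + d + 2) with h | h
    · rw [hx'x i h.le, hx'x (i + 1) h]; exact hx i h
    · obtain rfl : i = k + d + 2 := by omega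
      rw [hx'x _ le_rfl, hx'M, hx2]; exact hM2
  · rw [hx'x 0 (by omega), hx0]
  · rw [Nat.add_sub_assoc (by norm_num), hx'x _ (by norm_num), hx2]
  · intro i hi
    have h := mul_pos (hall i hi.le) (hall (i + 1) hi)
    have h2 : (-1 : ℝ) ^ (i + 1) * (-1) ^ (i + 1) = 1 := by rw [← mul_pow]; norm_num
    rw [pow_succ _ (i + 1)] at h
    linear_combination h - (aeval (x' i) (tracePoly k d N a) *
      aeval (x' (i + 1)) (tracePoly k d N a)) * h2

/-! ### Discarding finitely many parameters. -/

theorem infinite_salem_of_odd {k d : ℕ} (hk : Odd k) (hd : Odd d) :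
    {α : ℝ | IsSalemNumber α ∧ (minpoly ℚ α).natDegree = 2 * (k + d + 3) ∧
      IsAlgebraicUnit (α ^ (2 * (k + 1)) - 1)}.Infinite := by
  obtain ⟨N, hN, hev⟩ := eventually_isSalemTrace hk hd
  obtain ⟨A, hA⟩ := eventually_atTop.1 hev
  have hex : ∀ a, ∃ α : ℝ, A ≤ a → 1 < α ∧ IsSalemTrace (tracePoly k d N a) (α + α⁻¹) := by
    intro a
    by_cases ha : A ≤ a
    · obtain ⟨β, hβ⟩ := hA a ha
      obtain ⟨α, h1, rfl⟩ := exists_add_inv_eq_of_two_lt hβ.two_lt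
      exact ⟨α, fun _ => ⟨h1, hβ⟩⟩
    · exact ⟨0, fun h => absurd h ha⟩
  choose α hα using hex
  set Z := {z : ℂ | ∃ Q : ℤ[X], Q.Monic ∧ Q.natDegree ≤ 2 * (k + d + 3) ∧
    (∀ w : ℂ, aeval w Q = 0 → ‖w‖ ≤ 1) ∧ aeval z Q = 0}
  have hbad : (⋃ z ∈ Z, {a : ℕ | aeval z (traceLift (tracePoly k d N a)) = 0}).Finite := by
    refine (finite_roots_in_unit_disc _).biUnion fun z _ => Set.Subsingleton.finite ?_
    have hroot : ∀ a, aeval z (traceLift (tracePoly k d N a)) = 0 →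
        aeval (z + z⁻¹) (tracePoly k d N a) = 0 := by
      intro a ha
      have hz : z ≠ 0 := by
        rintro rfl
        rw [aeval_zero_traceLift (monic_tracePoly_and_natDegree k d N a).1] at ha
        exact one_ne_zero ha
      rw [aeval_traceLift _ hz] at ha
      exact (mul_eq_zero.1 ha).resolve_left (pow_ne_zero _ hz)
    exact fun a ha b hb => tracePoly_param_unique hN (hroot a ha) (hroot b hb)
  refine Set.infinite_of_injOn_mapsTo (f := α) ?_ ?_
    ((Set.Ici_infinite A).sdiff hbad)
  · intro a ha b hb hab
    have h1 := (hα a ha.1).2.root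
    have h2 := (hα b hb.1).2.root
    rw [← hab] at h2
    exact tracePoly_param_unique hN h1 h2
  · intro a ha
    obtain ⟨h1, h⟩ := hα a ha.1
    have hdeg := (monic_tracePoly_and_natDegree k d N a).2
    have hsal : IsSalemNumber (α a) ∧ (minpoly ℚ (α a)).natDegree = 2 * (k + d + 3) := by
      rcases h.isSalemNumber_or h1 rfl with hs | ⟨z, hz, hQ⟩
      · rwa [hdeg] at hs
      · rw [hdeg] at hQ
        exact absurd (Set.mem_biUnion (show z ∈ Z from hQ) hz) ha.2
    refine ⟨hsal.1, hsal.2, ?_⟩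
    have h0 : α a ≠ 0 := by linarith
    have hint := h.isIntegral h1 rfl
    have hint' : IsIntegral ℤ (α a)⁻¹ := by
      have hb : IsIntegral ℤ (α a + (α a)⁻¹) := ⟨_, h.monic, h.root⟩
      simpa using hb.sub hint
    refine isAlgebraicUnit_pow_sub_one h0 hint hint' k
      (G := X ^ (d + 1) - C (a : ℤ) * rationalFactor d N) ?_
    have := h.root
    rw [tracePoly, map_sub, map_one] at this
    exact sub_eq_zero.1 this

theorem theorem1p3 (n : ℕ) (hn : n ≡ 4 [MOD 8]) (hn5 : ¬ 5 ∣ n)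
    (t : ℕ) (ht : Odd t) (hnt : ((n : ℝ) + 6) / 2 ≤ (t : ℝ)) :
    {α : ℝ | IsSalemNumber α ∧ (minpoly ℚ α).natDegree = 2 * t ∧
      IsAlgebraicUnit (α ^ n - 1)}.Infinite := by
  have hn' : n % 8 = 4 := hn
  have hnt' : n + 6 ≤ 2 * t := by
    rw [div_le_iff₀ two_pos] at hnt
    exact_mod_cast (by linarith : (n : ℝ) + 6 ≤ 2 * t)
  obtain ⟨s, hs⟩ := ht
  -- For `n = 8 * m + 4` this is `k = 4 * m + 1`.
  obtain ⟨k, hk, rfl⟩ : ∃ k, Odd k ∧ n = 2 * (k + 1) :=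
    ⟨n / 2 - 1, ⟨n / 4 / 2 * 2, by omega⟩, by omega⟩
  -- The bound on `t` reads `t ≥ k + 4`, so `d ≥ 1`; it is odd because `t` and `k` are.
  obtain ⟨d, hd, rfl⟩ : ∃ d, Odd d ∧ t = k + d + 3 := by
    obtain ⟨l, hl⟩ := hk
    exact ⟨t - k - 3, ⟨(t - k - 4) / 2, by omega⟩, by omega⟩
  exact infinite_salem_of_odd hk hd
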